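/- There are universal constants $C,c,K>0$ such that the following holds for all integers $d,r,m\ge 0$ and every real $\delta$ with $0<\delta\le\sqrt{2/\pi}$. Let $A_1,\dots,A_m$ be random $d\times d$ real matrices all of whose $md^2$ entries are i.i.d. standard Gaussian, and suppose $m\ge (K/\delta^4)\,d^2$ (so $m\gtrsim d^2$ for each fixed $\delta$). Write $\langle X,Y\rangle=\mathrm{Tr}(X^\top Y)$, let $\|\cdot\|_F$ be the Frobenius norm, and put $\|X\|_{F,r}=\sup\{\langle X,Y\rangle : \|Y\|_F=1,\ \mathrm{rank}(Y)\le r\}$ (with value $0$ if there is no such $Y$). Let $\mathrm{Sign}(x)=\{x/|x|\}$ for $x\ne0$, $\mathrm{Sign}(0)=[-1,1]$, and, in the noiseless case $\mathbf s=0$, let $$\mathcal Q(X)=\frac1m\sum_{i=1}^m \mathrm{Sign}(\langle A_i,X\rangle)\,A_i .$$ Then, with probability at least $1-Ce^{-cm\delta^4}$, Sign-RIP holds with parameters $(r,\delta)$ and the constant scaling function $\varphi(X)=\sqrt{2/\pi}$; that is, for every nonzero $X\in\mathbb R^{d\times d}$ with $\mathrm{rank}(X)\le r$ and every $Q\in\mathcal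 Q(X)$ simultaneously, $$\left\|Q-\sqrt{\tfrac2\pi}\,\frac{X}{\|X\|_F}\right\|_{F,r}\le\sqrt{\tfrac2\pi}\,\delta .$$ -/

import Mathlib

open scoped Matrix.Norms.Frobenius

-- With this `open`, `‖X‖` on matrices is the Frobenius norm.

/-- The trace inner product `⟨X, Y⟩ = Tr (Xᵀ Y)` of two real `d × d` matrices. -/
def frobInner {d : ℕ} (X Y : Matrix (Fin d) (Fin d) ℝ) : ℝ :=
  (X.transpose * Y).trace

/-- The unit rank-`r` sphere: matrices of Frobenius norm one and rank at most `r`. -/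
def rankSphere (d r : ℕ) : Set (Matrix (Fin d) (Fin d) ℝ) :=
  {X | ‖X‖ = 1 ∧ X.rank ≤ r}

/-- The rank-restricted Frobenius norm `‖X‖_{F,r}`, the supremum of `⟨X, Y⟩` over the unit
rank-`r` sphere. -/
noncomputable def frobNormRank {d : ℕ} (r : ℕ) (X : Matrix (Fin d) (Fin d) ℝ) : ℝ :=
  sSup (frobInner X '' rankSphere d r)

/-- The set-valued sign: `x / |x|` for `x ≠ 0`, and the whole interval `[-1, 1]` at `0`. -/
def signSet (x : ℝ) : Set ℝ :=
  {t | (x ≠ 0 → t = x / |x|) ∧ (x = 0 → t ∈ Set.Icc (-1) 1)}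

/-- The set `(1/m) ∑ᵢ Sign(⟨Aᵢ, X⟩ - sᵢ) Aᵢ` attached to the measurement matrices `A` and the
noise vector `s`. -/
def signAverage {d m : ℕ} (A : Fin m → Matrix (Fin d) (Fin d) ℝ) (s : Fin m → ℝ)
    (X : Matrix (Fin d) (Fin d) ℝ) : Set (Matrix (Fin d) (Fin d) ℝ) :=
  {Q | ∃ t : Fin m → ℝ, (∀ i, t i ∈ signSet (frobInner (A i) X - s i)) ∧
    Q = (1 / (m : ℝ)) • ∑ i, t i • A i}

/-- Sign-RIP with parameters `(r, δ)` and scaling function `φ`. The condition ranges over nonzero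
matrices of rank at most `r`, since it involves `X / ‖X‖`. -/
def SignRIP {d m : ℕ} (A : Fin m → Matrix (Fin d) (Fin d) ℝ) (s : Fin m → ℝ) (r : ℕ) (δ : ℝ)
    (φ : Matrix (Fin d) (Fin d) ℝ → ℝ) : Prop :=
  ∀ X : Matrix (Fin d) (Fin d) ℝ, X ≠ 0 → X.rank ≤ r → ∀ Q ∈ signAverage A s X,
    frobNormRank r (Q - (φ X / ‖X‖) • X) ≤ φ X * δ

/-- The random matrices `A₁, …, Aₘ` have i.i.d. standard Gaussian entries (jointly over the
matrices and their entries). -/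
structure IsStdGaussianEnsemble {Ω : Type*} [MeasurableSpace Ω] (μ : MeasureTheory.Measure Ω)
    {d m : ℕ} (A : Fin m → Ω → Matrix (Fin d) (Fin d) ℝ) : Prop where
  law : ∀ i j k,
    ProbabilityTheory.HasLaw (fun ω => A i ω j k) (ProbabilityTheory.gaussianReal 0 1) μ
  indep : ProbabilityTheory.iIndepFun
    (fun (p : Fin m × Fin d × Fin d) (ω : Ω) => A p.1 ω p.2.1 p.2.2) μ

/-!
# Sign-RIP for Gaussian measurements

The rank constraint plays no role: the estimate is proved for all `X` and `Y` at once. Reading the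
`d × d` matrices as vectors of a Euclidean space `E` of dimension `n = d ^ 2`, the `A i` become
independent standard Gaussian vectors `a i`, and the claim is that for every unit vector `x` and
all admissible sign weights `t i`, the average `(1 / m) ∑ t i • a i` lies within `√(2 / π) δ` of
`√(2 / π) x`.

For fixed `x` the mean of `sign ⟨x, a⟩ ⟨y, a⟩` is `√(2 / π) ⟨x, y⟩`, by invariance of the Gaussian
measure under the reflection across the line of `x`
(`integral_sign_inner_mul_inner_stdGaussian`). The weights are discontinuous in `x`, so a plain net
argument is not enough. Take a net `N` of the sphere of mesh of order `δ ^ 3` and control three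
statistics for `x`, `y` in `N`:

* the number of `i` with `|⟨x, a i⟩| ≤ τ`, for `τ` of order `δ ^ 2`, is of order `m δ ^ 2`;
* `∑ ⟨y, a i⟩ ^ 2 ≤ 4 m`;
* the average of `sign ⟨x, a i⟩ ⟨y, a i⟩` exceeds its mean by at most `δ / 16`.

Each fails with probability `exp (-c m δ ^ 2)`, by the exponential Markov inequality. When all hold,
passing from a unit vector `x` to a net point `y` changes the sign of only those terms with
`|⟨y, a i⟩| ≤ τ` or `|⟨x - y, a i⟩| ≥ τ`; these are a fraction of order `δ ^ 2` of the terms, and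
Cauchy–Schwarz bounds their contribution by a small multiple of `δ`
(`norm_sign_average_sub_le`). The union bound costs `(C / δ ^ 3) ^ (2 n)`, and since
`log (1 / δ) ≤ δ⁻²` this is absorbed by `exp (-c m δ ^ 2)` when `m ≥ K n / δ ^ 4`
(`measure_pi_stdGaussian_sign_average_le`).
-/

section

open MeasureTheory ProbabilityTheory Real Metric
open scoped ENNReal NNReal

/-! ### Nets of the unit sphere -/

/-- Volume comparison: the balls of radius `ε / 2` around the points of an `ε`-separated subset of
the unit sphere are disjoint and lie in the ball of radius `3 / 2`. -/
lemma card_le_of_separated_of_norm_eq_one {E : Type*} [NormedAddCommGroup E] [NormedSpace ℝ E]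
    [FiniteDimensional ℝ E] {ε : ℝ} (hε : 0 < ε) (hε1 : ε ≤ 1) (s : Finset E)
    (hs : ∀ x ∈ s, ‖x‖ = 1) (h : ∀ x ∈ s, ∀ y ∈ s, x ≠ y → ε < dist x y) :
    (s.card : ℝ) ≤ (3 / ε) ^ Module.finrank ℝ E := by
  borelize E
  let ν : Measure E := Measure.addHaar
  set A := ⋃ c ∈ s, ball (c : E) (ε / 2) with hA
  have D : Set.Pairwise (s : Set E) (Function.onFun Disjoint fun c => ball (c : E) (ε / 2)) := by
    rintro c hc d hd hcd
    apply ball_disjoint_ball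
    linarith [h c hc d hd hcd]
  have A_subset : A ⊆ ball (0 : E) (3 / 2) := by
    refine Set.iUnion₂_subset fun x hx => ball_subset_ball' ?_
    rw [dist_zero_right, hs x hx]
    linarith
  have I : (s.card : ℝ≥0∞) * ENNReal.ofReal ((ε / 2) ^ Module.finrank ℝ E) * ν (ball 0 1) ≤
      ENNReal.ofReal ((3 / 2) ^ Module.finrank ℝ E) * ν (ball 0 1) :=
    calc
      _ = ν A := by
        rw [hA, measure_biUnion_finset D fun c _ => measurableSet_ball]
        simp only [ν.addHaar_ball_of_pos _ (half_pos hε), Finset.sum_const, nsmul_eq_mul, mul_assoc]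
      _ ≤ ν (ball (0 : E) (3 / 2)) := measure_mono A_subset
      _ = _ := by simp only [ν.addHaar_ball_of_pos _ (show (0 : ℝ) < 3 / 2 by norm_num)]
  have J := (ENNReal.mul_le_mul_iff_left (measure_ball_pos ν _ zero_lt_one).ne'
    measure_ball_lt_top.ne).1 I
  have K := ENNReal.toReal_le_of_le_ofReal (by positivity) J
  rw [ENNReal.toReal_mul, ENNReal.toReal_natCast, ENNReal.toReal_ofReal (by positivity),
    ← le_div_iff₀ (by positivity), ← div_pow] at K
  rwa [show (3 : ℝ) / 2 / (ε / 2) = 3 / ε by field_simp] at K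

/-- The unit sphere of a normed space of dimension `n` has an `ε`-net of at most `(3 / ε) ^ n`
points. -/
lemma exists_finset_sphere_net (E : Type*) [NormedAddCommGroup E] [NormedSpace ℝ E]
    [FiniteDimensional ℝ E] {ε : ℝ} (hε : 0 < ε) (hε1 : ε ≤ 1) :
    ∃ N : Finset E, (∀ x ∈ N, ‖x‖ = 1) ∧ (∀ x : E, ‖x‖ = 1 → ∃ y ∈ N, dist x y ≤ ε) ∧
      (N.card : ℝ) ≤ (3 / ε) ^ Module.finrank ℝ E := by
  classical
  let P : ℕ → Prop := fun k => ∃ s : Finset E, s.card = k ∧ (∀ x ∈ s, ‖x‖ = 1) ∧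
    ∀ x ∈ s, ∀ y ∈ s, x ≠ y → ε < dist x y
  have hb : ∀ k, P k → k ≤ ⌊(3 / ε) ^ Module.finrank ℝ E⌋₊ := by
    rintro k ⟨s, rfl, hs, h⟩
    exact Nat.le_floor (card_le_of_separated_of_norm_eq_one hε hε1 s hs h)
  have hP0 : P 0 := ⟨∅, rfl, by simp, by simp⟩
  obtain ⟨N, hNk, hN, hsep⟩ : P (Nat.findGreatest P ⌊(3 / ε) ^ Module.finrank ℝ E⌋₊) :=
    Nat.findGreatest_spec (Nat.zero_le _) hP0
  refine ⟨N, hN, fun x hx => ?_, card_le_of_separated_of_norm_eq_one hε hε1 N hN hsep⟩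
  -- Otherwise adjoining `x` would give a larger separated set.
  by_contra! hcon
  have hxN : x ∉ N := fun hmem => by
    have := hcon x hmem
    rw [dist_self] at this
    linarith
  have hP : P (N.card + 1) := by
    refine ⟨insert x N, Finset.card_insert_of_notMem hxN, ?_, ?_⟩
    · intro y hy
      rcases Finset.mem_insert.1 hy with rfl | hy
      exacts [hx, hN y hy]
    · intro y hy z hz hyz
      rcases Finset.mem_insert.1 hy with hy | hy <;> rcases Finset.mem_insert.1 hz with hz | hz
      · exact absurd (hy.trans hz.symm) hyz
      · rw [hy]; exact hcon z hz
      · rw [hz, dist_comm]; exact hcon y hy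
      · exact hsep y hy z hz hyz
  have := Nat.le_findGreatest (hb _ hP) hP
  omega

/-! ### The exponential Markov inequality for sums of i.i.d. terms -/

lemma measure_pi_le_sum_le_exp {E : Type*} [MeasurableSpace E] (γ : Measure E)
    [IsProbabilityMeasure γ] {f : E → ℝ} (hf : Measurable f) {b : ℝ}
    (h : ∫⁻ x, ENNReal.ofReal (exp (f x)) ∂γ ≤ ENNReal.ofReal (exp b)) (m : ℕ) (s : ℝ) :
    Measure.pi (fun _ : Fin m => γ) {a | s ≤ ∑ i, f (a i)} ≤
      ENNReal.ofReal (exp (m * b - s)) := by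
  let X : Fin m → (Fin m → E) → ℝ≥0∞ := fun i a => ENNReal.ofReal (exp (f (a i)))
  have hXm : ∀ i, Measurable (X i) := fun i => by fun_prop
  have hind : iIndepFun X (Measure.pi (fun _ : Fin m => γ)) :=
    iIndepFun_pi (μ := fun _ : Fin m => γ) (X := fun _ x => ENNReal.ofReal (exp (f x)))
      (fun i => by fun_prop)
  have hprod : ∫⁻ a, ∏ i, X i a ∂(Measure.pi (fun _ : Fin m => γ)) ≤
      ENNReal.ofReal (exp b) ^ m := by
    rw [lintegral_prod_eq_prod_lintegral_of_indepFun Finset.univ X hind hXm]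
    refine (Finset.prod_le_pow_card _ _ (ENNReal.ofReal (exp b)) fun i _ => ?_).trans_eq (by simp)
    have := (measurePreserving_eval (fun _ : Fin m => γ) i).lintegral_comp
      (f := fun x => ENNReal.ofReal (exp (f x))) (by fun_prop)
    exact this.le.trans h
  have hsub : {a : Fin m → E | s ≤ ∑ i, f (a i)} ⊆
      {a | ENNReal.ofReal (exp s) ≤ ∏ i, X i a} := by
    intro a ha
    simp only [Set.mem_ofPred_eq, X] at ha ⊢
    rw [← ENNReal.ofReal_prod_of_nonneg (fun i _ => (exp_pos _).le), ← exp_sum]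
    exact ENNReal.ofReal_le_ofReal (exp_le_exp.2 ha)
  refine (measure_mono hsub).trans ?_
  refine (meas_ge_le_lintegral_div (by fun_prop) (by simp [exp_pos]) ENNReal.ofReal_ne_top).trans ?_
  refine (ENNReal.div_le_div_right hprod _).trans_eq ?_
  rw [← ENNReal.ofReal_pow (exp_pos _).le, ← ENNReal.ofReal_div_of_pos (exp_pos _), ← exp_nat_mul,
    ← exp_sub]

/-! ### One-dimensional Gaussian integrals -/

lemma gaussianPDFReal_zero_one (x : ℝ) :
    gaussianPDFReal 0 1 x = (√(2 * π))⁻¹ * exp (-(1 / 2) * x ^ 2) := by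
  simp only [gaussianPDFReal_def, NNReal.coe_one, mul_one, sub_zero]
  congr 2
  ring

lemma lintegral_exp_mul_sq_gaussianReal {s : ℝ} (hs : s < 1 / 2) :
    ∫⁻ x, ENNReal.ofReal (exp (s * x ^ 2)) ∂(gaussianReal 0 1) =
      ENNReal.ofReal (√(1 - 2 * s))⁻¹ := by
  have hb : 0 < 1 / 2 - s := by linarith
  have e : ∀ x : ℝ, gaussianPDF 0 1 x * ENNReal.ofReal (exp (s * x ^ 2)) =
      ENNReal.ofReal ((√(2 * π))⁻¹ * exp (-(1 / 2 - s) * x ^ 2)) := by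
    intro x
    rw [gaussianPDF, ← ENNReal.ofReal_mul (gaussianPDFReal_nonneg _ _ _), gaussianPDFReal_zero_one,
      mul_assoc, ← exp_add]
    congr 3
    ring
  rw [gaussianReal_of_var_ne_zero _ one_ne_zero,
    lintegral_withDensity_eq_lintegral_mul _ (measurable_gaussianPDF 0 1) (by fun_prop)]
  simp only [Pi.mul_apply, e]
  rw [← ofReal_integral_eq_lintegral_ofReal ((integrable_exp_neg_mul_sq hb).const_mul _)
    (Filter.Eventually.of_forall fun x => by positivity), integral_const_mul, integral_gaussian,
    ← sqrt_inv, ← sqrt_inv, ← sqrt_mul (by positivity)]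
  congr 2
  have := pi_pos
  have : 1 - 2 * s ≠ 0 := by linarith
  field_simp

lemma integrable_exp_mul_sq_gaussianReal {s : ℝ} (hs : s < 1 / 2) :
    Integrable (fun x => exp (s * x ^ 2)) (gaussianReal 0 1) := by
  refine ⟨by fun_prop, ?_⟩
  rw [hasFiniteIntegral_iff_ofReal (Filter.Eventually.of_forall fun x => (exp_pos _).le),
    lintegral_exp_mul_sq_gaussianReal hs]
  exact ENNReal.ofReal_lt_top

lemma integral_exp_mul_sq_gaussianReal {s : ℝ} (hs : s < 1 / 2) :
    ∫ x, exp (s * x ^ 2) ∂(gaussianReal 0 1) = (√(1 - 2 * s))⁻¹ := by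
  rw [integral_eq_lintegral_of_nonneg_ae (Filter.Eventually.of_forall fun x => (exp_pos _).le)
    (by fun_prop), lintegral_exp_mul_sq_gaussianReal hs, ENNReal.toReal_ofReal (by positivity)]

lemma integral_abs_gaussianReal_zero_one : ∫ x, |x| ∂(gaussianReal 0 1) = √(2 / π) := by
  have h := integral_rpow_mul_exp_neg_mul_rpow (p := 2) (q := 1) (b := 1 / 2)
    (by norm_num) (by norm_num) (by norm_num)
  have h1 : ∫ x in Set.Ioi (0 : ℝ), x * exp (-(1 / 2) * x ^ 2) = 1 := by
    have e : (-(1 + 1) / 2 : ℝ) = -1 := by norm_num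
    rw [e, rpow_neg_one] at h
    norm_num [Gamma_one] at h ⊢
    exact h
  rw [integral_gaussianReal_eq_integral_smul one_ne_zero]
  simp only [gaussianPDFReal_zero_one, smul_eq_mul]
  have e : ∀ x : ℝ, (√(2 * π))⁻¹ * exp (-(1 / 2) * x ^ 2) * |x| =
      (√(2 * π))⁻¹ * (|x| * exp (-(1 / 2) * |x| ^ 2)) := by
    intro x; simp only [sq_abs]; ring
  simp only [e]
  rw [integral_comp_abs (f := fun y : ℝ => (√(2 * π))⁻¹ * (y * exp (-(1 / 2) * y ^ 2))),
    integral_const_mul, h1, ← sqrt_inv, mul_one]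
  rw [show (2 : ℝ) / π = 2 ^ 2 * (2 * π)⁻¹ by have := pi_pos; field_simp,
    sqrt_mul (by norm_num), sqrt_sq (by norm_num)]

/-- Small-ball estimate: the standard Gaussian density is at most `1 / 2`. -/
lemma gaussianReal_zero_one_abs_le (τ : ℝ) :
    gaussianReal 0 1 {x | |x| ≤ τ} ≤ ENNReal.ofReal τ := by
  rw [gaussianReal_apply _ one_ne_zero]
  have hpdf : ∀ x, gaussianPDF 0 1 x ≤ ENNReal.ofReal (1 / 2) := by
    intro x
    refine ENNReal.ofReal_le_ofReal ?_
    rw [gaussianPDFReal_zero_one]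
    have h2 : (2 : ℝ) ≤ √(2 * π) := le_sqrt_of_sq_le (by nlinarith [pi_gt_three])
    have h3 : (√(2 * π))⁻¹ ≤ 1 / 2 := by
      rw [one_div]; exact inv_anti₀ (by norm_num) h2
    have h4 : exp (-(1 / 2) * x ^ 2) ≤ 1 := exp_le_one_iff.2 (by nlinarith [sq_nonneg x])
    calc _ ≤ 1 / 2 * 1 := mul_le_mul h3 h4 (exp_pos _).le (by norm_num)
      _ = 1 / 2 := by norm_num
  have hset : {x : ℝ | |x| ≤ τ} = Set.Icc (-τ) τ := by ext x; simp [abs_le]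
  calc _ ≤ ∫⁻ _ in {x : ℝ | |x| ≤ τ}, ENNReal.ofReal (1 / 2) := lintegral_mono hpdf
    _ = ENNReal.ofReal τ := by
      rw [setLIntegral_const, hset, Real.volume_Icc, ← ENNReal.ofReal_mul (by norm_num)]
      congr 1; ring

/-! ### Elementary inequalities -/

lemma exp_le_add_exp_sq (x : ℝ) : exp x ≤ x + exp (x ^ 2) := by
  have h1 := add_one_le_exp (x ^ 2)
  rcases le_or_gt |x| 1 with h | h
  · have := (abs_le.1 (abs_exp_sub_one_sub_id_le h)).2
    linarith
  · rcases lt_abs.1 h with h | h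
    · have : exp x ≤ exp (x ^ 2) := exp_le_exp.2 (by nlinarith)
      linarith
    · have : exp x ≤ 1 := exp_le_one_iff.2 (by linarith)
      nlinarith

lemma inv_sqrt_one_sub_le_exp {x : ℝ} (h0 : 0 ≤ x) (h : x ≤ 1 / 2) : (√(1 - x))⁻¹ ≤ exp x := by
  have h1 : exp (-x) ≤ √(1 - x) := by
    refine le_sqrt_of_sq_le ?_
    rw [← exp_nat_mul]
    have h2 : exp (-(2 * x)) * (1 + 2 * x) ≤ 1 := by
      have := mul_le_mul_of_nonneg_left (add_one_le_exp (2 * x)) (exp_pos (-(2 * x))).le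
      rw [← exp_add] at this
      simpa [add_comm] using this
    have h3 : (1 : ℝ) ≤ (1 - x) * (1 + 2 * x) := by nlinarith
    have : exp (-(2 * x)) ≤ 1 - x := by
      refine le_of_mul_le_mul_right (h2.trans h3) (by linarith)
    convert this using 2
    push_cast; ring
  rw [← neg_neg x, exp_neg (-x), neg_neg]
  exact inv_anti₀ (exp_pos _) h1

/-! ### Linear functionals of a standard Gaussian vector -/

section GaussianVector

variable {E : Type*} [NormedAddCommGroup E] [InnerProductSpace ℝ E] [FiniteDimensional ℝ E]
  [MeasurableSpace E] [BorelSpace E]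

lemma measurePreserving_inner_stdGaussian {u : E} (hu : ‖u‖ = 1) :
    MeasurePreserving (fun a => inner ℝ u a) (stdGaussian E) (gaussianReal 0 1) := by
  refine ⟨by fun_prop, ?_⟩
  have h : HasGaussianLaw (fun a : E => innerSL ℝ u a) (stdGaussian E) :=
    IsGaussian.hasGaussianLaw_id.map_fun (innerSL ℝ u)
  have h' := h.map_eq_gaussianReal
  have hv := variance_dual_stdGaussian (innerSL ℝ u : StrongDual ℝ E)
  have hi := integral_strongDual_stdGaussian (innerSL ℝ u : StrongDual ℝ E)
  rw [innerSL_apply_norm, hu] at hv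
  rw [hi, hv] at h'
  simpa using h'

lemma Real.measurable_sign : Measurable Real.sign := by
  unfold Real.sign
  exact Measurable.ite measurableSet_Iio measurable_const
    (Measurable.ite measurableSet_Ioi measurable_const measurable_const)

lemma Real.abs_sign_le_one (x : ℝ) : |Real.sign x| ≤ 1 := by
  rcases Real.sign_apply_eq x with h | h | h <;> simp [h]

lemma Real.sign_mul_self (x : ℝ) : Real.sign x * x = |x| := by
  rcases lt_trichotomy x 0 with h | rfl | h
  · rw [Real.sign_of_neg h, abs_of_neg h, neg_one_mul]
  · simp
  · rw [Real.sign_of_pos h, abs_of_pos h, one_mul]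

lemma integrable_inner_stdGaussian (u : E) :
    Integrable (fun a => inner ℝ u a) (stdGaussian E) :=
  IsGaussian.integrable_dual (stdGaussian E) (innerSL ℝ u)

lemma integrable_sign_inner_mul_inner_stdGaussian (u v : E) :
    Integrable (fun a => Real.sign (inner ℝ u a) * inner ℝ v a) (stdGaussian E) := by
  refine (integrable_inner_stdGaussian v).bdd_mul (c := 1)
    (Real.measurable_sign.comp (by fun_prop)).aestronglyMeasurable
    (Filter.Eventually.of_forall fun a => ?_)
  exact Real.abs_sign_le_one _

/-- The reflection across the line spanned by `u` preserves the Gaussian measure and the value of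
`⟨u, a⟩`, while averaging `v` with its mirror image leaves `⟨u, v⟩ u`; so the integral reduces to
`⟨u, v⟩` times the first absolute moment of a standard Gaussian. -/
lemma integral_sign_inner_mul_inner_stdGaussian {u : E} (hu : ‖u‖ = 1) (v : E) :
    ∫ a, Real.sign (inner ℝ u a) * inner ℝ v a ∂(stdGaussian E) =
      √(2 / π) * inner ℝ u v := by
  set R := (Submodule.span ℝ {u}).reflection with hR
  have hRu : R u = u :=
    Submodule.reflection_mem_subspace_eq_self (Submodule.mem_span_singleton_self u)
  have hRv : v + R v = (2 * inner ℝ u v) • u := by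
    rw [hR, Submodule.reflection_singleton_apply, hu]
    simp [two_smul, mul_smul]
  have hinner : ∀ x a : E, inner ℝ x (R a) = inner ℝ (R x) a := by
    intro x a
    rw [← R.inner_map_map x (R a), Submodule.reflection_reflection]
  have hmp : MeasurePreserving R (stdGaussian E) (stdGaussian E) :=
    ⟨R.continuous.measurable, stdGaussian_map R⟩
  have h1 : ∫ a, Real.sign (inner ℝ u a) * inner ℝ v a ∂(stdGaussian E) =
      ∫ a, Real.sign (inner ℝ u a) * inner ℝ (R v) a ∂(stdGaussian E) := by
    rw [← hmp.integral_comp R.toHomeomorph.measurableEmbedding]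
    simp only [hinner, hRu]
  have h2 : ∫ a, Real.sign (inner ℝ u a) * inner ℝ v a ∂(stdGaussian E) +
      ∫ a, Real.sign (inner ℝ u a) * inner ℝ (R v) a ∂(stdGaussian E) =
      2 * inner ℝ u v * √(2 / π) := by
    rw [← integral_add (integrable_sign_inner_mul_inner_stdGaussian u v)
      (integrable_sign_inner_mul_inner_stdGaussian u (R v))]
    have e : ∀ a : E, Real.sign (inner ℝ u a) * inner ℝ v a +
        Real.sign (inner ℝ u a) * inner ℝ (R v) a =
        2 * inner ℝ u v * |inner ℝ u a| := by
      intro a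
      rw [← mul_add, ← inner_add_left, hRv, real_inner_smul_left, mul_left_comm,
        Real.sign_mul_self]
    simp only [e]
    rw [integral_const_mul, ← integral_abs_gaussianReal_zero_one,
      ← (measurePreserving_inner_stdGaussian hu).map_eq, integral_map (by fun_prop) (by fun_prop)]
  linarith

/-! ### Exponential moments of the three statistics -/

/-- Sub-Gaussian bound: `exp x ≤ x + exp (x ^ 2)` removes the centred linear term, so only a small
exponential moment of `⟨v, a⟩ ^ 2` is needed and not the joint law of `⟨u, a⟩` and `⟨v, a⟩`. -/
lemma lintegral_exp_sign_inner_mul_inner_le {u v : E} (hu : ‖u‖ = 1) (hv : ‖v‖ = 1) {t : ℝ}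
    (ht : t ^ 2 ≤ 1 / 8) :
    ∫⁻ a, ENNReal.ofReal (exp (t * (Real.sign (inner ℝ u a) * inner ℝ v a -
      √(2 / π) * inner ℝ u v))) ∂(stdGaussian E) ≤ ENNReal.ofReal (exp (6 * t ^ 2)) := by
  set Z : E → ℝ := fun a => Real.sign (inner ℝ u a) * inner ℝ v a - √(2 / π) * inner ℝ u v with hZ
  set W : E → ℝ := fun a => exp (2 * t ^ 2 * (inner ℝ v a) ^ 2) with hW
  have hs : 2 * t ^ 2 < 1 / 2 := by linarith
  have hmp := measurePreserving_inner_stdGaussian hv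
  have hWint : Integrable W (stdGaussian E) :=
    hmp.integrable_comp_of_integrable (integrable_exp_mul_sq_gaussianReal hs)
  have hWval : ∫ a, W a ∂(stdGaussian E) ≤ exp (4 * t ^ 2) := by
    have : ∫ a, W a ∂(stdGaussian E) = (√(1 - 4 * t ^ 2))⁻¹ := by
      rw [show 4 * t ^ 2 = 2 * (2 * t ^ 2) by ring, ← integral_exp_mul_sq_gaussianReal hs,
        ← hmp.map_eq, integral_map (by fun_prop) (by fun_prop)]
    rw [this]
    exact inv_sqrt_one_sub_le_exp (by positivity) (by linarith)
  have hZint : Integrable Z (stdGaussian E) :=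
    (integrable_sign_inner_mul_inner_stdGaussian u v).sub (integrable_const _)
  have hZval : ∫ a, Z a ∂(stdGaussian E) = 0 := by
    rw [hZ, integral_sub (integrable_sign_inner_mul_inner_stdGaussian u v) (integrable_const _),
      integral_sign_inner_mul_inner_stdGaussian hu]
    simp
  have hpt : ∀ a, exp (t * Z a) ≤ t * Z a + exp (2 * t ^ 2) * W a := by
    intro a
    refine (exp_le_add_exp_sq _).trans ?_
    rw [hW, ← exp_add]
    gcongr
    have h1 : (Real.sign (inner ℝ u a) * inner ℝ v a) ^ 2 ≤ (inner ℝ v a) ^ 2 := by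
      rw [mul_pow]
      have : Real.sign (inner ℝ u a) ^ 2 ≤ 1 :=
        (sq_le_one_iff_abs_le_one _).2 (Real.abs_sign_le_one _)
      exact mul_le_of_le_one_left (sq_nonneg _) this
    have h2 : (√(2 / π) * inner ℝ u v) ^ 2 ≤ 1 := by
      have h3 : (inner ℝ u v) ^ 2 ≤ (1 : ℝ) := by
        rw [sq_le_one_iff_abs_le_one]
        simpa [hu, hv] using abs_real_inner_le_norm u v
      have h4 : 2 / π ≤ 1 := by rw [div_le_one pi_pos]; linarith [pi_gt_three]
      rw [mul_pow, sq_sqrt (by positivity)]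
      nlinarith [sq_nonneg (inner ℝ u v)]
    have h5 : Z a ^ 2 ≤ 2 * (inner ℝ v a) ^ 2 + 2 := by
      simp only [hZ]
      nlinarith [sq_nonneg (Real.sign (inner ℝ u a) * inner ℝ v a + √(2 / π) * inner ℝ u v)]
    rw [mul_pow]
    nlinarith [sq_nonneg t, mul_le_mul_of_nonneg_left h5 (sq_nonneg t)]
  have hgint : Integrable (fun a => t * Z a + exp (2 * t ^ 2) * W a) (stdGaussian E) :=
    (hZint.const_mul _).add (hWint.const_mul _)
  calc _ ≤ ∫⁻ a, ENNReal.ofReal (t * Z a + exp (2 * t ^ 2) * W a) ∂(stdGaussian E) :=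
        lintegral_mono fun a => ENNReal.ofReal_le_ofReal (hpt a)
    _ = ENNReal.ofReal (∫ a, (t * Z a + exp (2 * t ^ 2) * W a) ∂(stdGaussian E)) :=
        (ofReal_integral_eq_lintegral_ofReal hgint
          (Filter.Eventually.of_forall fun a => (exp_pos _).le.trans (hpt a))).symm
    _ ≤ _ := by
        refine ENNReal.ofReal_le_ofReal ?_
        rw [integral_add (hZint.const_mul _) (hWint.const_mul _), integral_const_mul,
          integral_const_mul, hZval, mul_zero, zero_add]
        calc _ ≤ exp (2 * t ^ 2) * exp (4 * t ^ 2) := by gcongr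
          _ = exp (6 * t ^ 2) := by rw [← exp_add]; ring_nf

lemma lintegral_exp_inner_sq_le {v : E} (hv : ‖v‖ = 1) :
    ∫⁻ a, ENNReal.ofReal (exp (1 / 4 * (inner ℝ v a) ^ 2)) ∂(stdGaussian E) ≤
      ENNReal.ofReal (exp (1 / 2)) := by
  rw [(measurePreserving_inner_stdGaussian hv).lintegral_comp
    (f := fun x => ENNReal.ofReal (exp (1 / 4 * x ^ 2))) (by fun_prop),
    lintegral_exp_mul_sq_gaussianReal (by norm_num)]
  refine ENNReal.ofReal_le_ofReal ?_
  rw [show (2 : ℝ) * (1 / 4) = 1 / 2 by norm_num]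
  exact inv_sqrt_one_sub_le_exp (by norm_num) le_rfl

lemma lintegral_exp_indicator_abs_inner_le {u : E} (hu : ‖u‖ = 1) {τ : ℝ} (hτ : 0 ≤ τ) :
    ∫⁻ a, ENNReal.ofReal (exp (if |inner ℝ u a| ≤ τ then 1 else 0)) ∂(stdGaussian E) ≤
      ENNReal.ofReal (exp (2 * τ)) := by
  set S : Set E := (fun a => inner ℝ u a) ⁻¹' {x : ℝ | |x| ≤ τ} with hS
  have hSm : MeasurableSet {x : ℝ | |x| ≤ τ} := measurableSet_le (by fun_prop) (by fun_prop)
  have hmp := measurePreserving_inner_stdGaussian hu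
  have hpt : ∀ a : E, ENNReal.ofReal (exp (if |inner ℝ u a| ≤ τ then 1 else 0)) ≤
      1 + S.indicator (fun _ => 2) a := by
    intro a
    by_cases h : |inner ℝ u a| ≤ τ
    · have ha : a ∈ S := h
      rw [if_pos h, Set.indicator_of_mem ha]
      calc _ ≤ ENNReal.ofReal 3 := ENNReal.ofReal_le_ofReal (by linarith [exp_one_lt_d9])
        _ = 1 + 2 := by norm_num
    · have ha : a ∉ S := h
      simp [if_neg h, Set.indicator_of_notMem ha]
  calc _ ≤ ∫⁻ a, (1 + S.indicator (fun _ => 2) a) ∂(stdGaussian E) := lintegral_mono hpt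
    _ = 1 + 2 * gaussianReal 0 1 {x | |x| ≤ τ} := by
      rw [lintegral_add_left measurable_const, lintegral_indicator_const (hmp.measurable hSm),
        hmp.measure_preimage hSm.nullMeasurableSet]
      simp
    _ ≤ 1 + 2 * ENNReal.ofReal τ := by gcongr; exact gaussianReal_zero_one_abs_le τ
    _ = ENNReal.ofReal (2 * τ + 1) := by
      rw [ENNReal.ofReal_add (by positivity) zero_le_one, ENNReal.ofReal_mul zero_le_two,
        add_comm]
      simp
    _ ≤ _ := ENNReal.ofReal_le_ofReal (add_one_le_exp _)

end GaussianVector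

/-! ### The deterministic estimate on the good event -/

section Deterministic

variable {E : Type*} [NormedAddCommGroup E] [InnerProductSpace ℝ E]

lemma norm_le_two_mul_of_net {N : Finset E} {ε : ℝ} (hε : ε ≤ 1 / 2)
    (hcov : ∀ x : E, ‖x‖ = 1 → ∃ y ∈ N, dist x y ≤ ε) {V : E} {B : ℝ} (hB : 0 ≤ B)
    (h : ∀ y ∈ N, inner ℝ y V ≤ B) : ‖V‖ ≤ 2 * B := by
  rcases eq_or_ne V 0 with rfl | hV
  · simpa using hB
  have hV' : ‖V‖ ≠ 0 := norm_ne_zero_iff.2 hV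
  have hu : ‖(‖V‖⁻¹ : ℝ) • V‖ = 1 := by rw [norm_smul, norm_inv, norm_norm, inv_mul_cancel₀ hV']
  obtain ⟨y, hy, hd⟩ := hcov _ hu
  have h1 : inner ℝ ((‖V‖⁻¹ : ℝ) • V) V = ‖V‖ := by
    rw [real_inner_smul_left, real_inner_self_eq_norm_sq]
    field_simp
  have h2 : inner ℝ ((‖V‖⁻¹ : ℝ) • V - y) V ≤ 1 / 2 * ‖V‖ := by
    refine (real_inner_le_norm _ _).trans ?_
    rw [dist_eq_norm] at hd
    exact mul_le_mul_of_nonneg_right (hd.trans hε) (norm_nonneg _)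
  rw [inner_sub_left, h1] at h2
  linarith [h y hy]

lemma sum_inner_sq_le_of_net {N : Finset E} {ε : ℝ} (hε : ε ≤ 1 / 2)
    (hcov : ∀ x : E, ‖x‖ = 1 → ∃ y ∈ N, dist x y ≤ ε) {m : ℕ} {a : Fin m → E}
    {B : ℝ} (hB : 0 ≤ B) (h : ∀ y ∈ N, ∑ i, (inner ℝ y (a i)) ^ 2 ≤ B ^ 2) (x : E) :
    ∑ i, (inner ℝ x (a i)) ^ 2 ≤ (2 * B * ‖x‖) ^ 2 := by
  let T : E →L[ℝ] EuclideanSpace ℝ (Fin m) :=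
    ((PiLp.continuousLinearEquiv 2 ℝ (fun _ : Fin m => ℝ)).symm : (Fin m → ℝ) →L[ℝ] _).comp
      (ContinuousLinearMap.pi fun i => innerSL ℝ (a i))
  have hT : ∀ x, ‖T x‖ ^ 2 = ∑ i, (inner ℝ x (a i)) ^ 2 := by
    intro x
    rw [EuclideanSpace.real_norm_sq_eq]
    refine Finset.sum_congr rfl fun i _ => ?_
    rw [real_inner_comm]
    rfl
  have hop : ‖T‖ ≤ B + 1 / 2 * ‖T‖ := by
    refine ContinuousLinearMap.opNorm_le_of_unit_norm (by positivity) fun x hx => ?_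
    obtain ⟨y, hy, hd⟩ := hcov x hx
    have h1 : ‖T y‖ ≤ B := abs_le_of_sq_le_sq' ((hT y).trans_le (h y hy)) hB |>.2
    have h2 : ‖T (x - y)‖ ≤ 1 / 2 * ‖T‖ := by
      refine (T.le_opNorm _).trans ?_
      rw [mul_comm]
      rw [dist_eq_norm] at hd
      exact mul_le_mul_of_nonneg_right (hd.trans hε) (norm_nonneg _)
    calc ‖T x‖ = ‖T y + T (x - y)‖ := by rw [← map_add]; congr 2; abel
      _ ≤ ‖T y‖ + ‖T (x - y)‖ := norm_add_le _ _
      _ ≤ _ := add_le_add h1 h2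
  rw [← hT]
  refine pow_le_pow_left₀ (norm_nonneg _) ((T.le_opNorm x).trans ?_) 2
  gcongr
  linarith

/-- A sign can change between two points `x` and `y` only if `y` is within `τ` of zero or `x - y`
is larger than `τ`. -/
lemma sq_sub_sign_le {t x y τ : ℝ} (hτ : 0 < τ) (ht : |t| ≤ 1) (hx : x ≠ 0 → t = Real.sign x) :
    (t - Real.sign y) ^ 2 ≤ 4 * ((if |y| ≤ τ then 1 else 0) + (x - y) ^ 2 / τ ^ 2) := by
  have hs := Real.abs_sign_le_one y
  have h4 : (t - Real.sign y) ^ 2 ≤ 4 := by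
    rw [abs_le] at ht hs
    nlinarith
  have hq : 0 ≤ (x - y) ^ 2 / τ ^ 2 := by positivity
  by_cases hy : |y| ≤ τ
  · rw [if_pos hy]
    linarith
  · rw [if_neg hy, zero_add]
    rcases le_or_gt τ |x - y| with h | h
    · have : 1 ≤ (x - y) ^ 2 / τ ^ 2 := by
        rw [one_le_div (by positivity), ← sq_abs (x - y)]
        exact pow_le_pow_left₀ hτ.le h 2
      linarith
    · have hts : t = Real.sign y := by
        rw [abs_lt] at h
        rcases lt_abs.1 (not_le.1 hy) with hy | hy
        · have hx0 : 0 < x := by linarith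
          rw [hx hx0.ne', Real.sign_of_pos hx0, Real.sign_of_pos (by linarith)]
        · have hx0 : x < 0 := by linarith
          rw [hx hx0.ne, Real.sign_of_neg hx0, Real.sign_of_neg (by linarith)]
      rw [hts, sub_self]
      linarith

/-- Cauchy–Schwarz: a bound on the quadratic form of the `a i` bounds the norm of each of their
linear combinations by the Euclidean norm of the coefficients. -/
lemma norm_sum_smul_sq_le {m : ℕ} {a : Fin m → E} {M : ℝ} (hM0 : 0 ≤ M)
    (hM : ∀ x : E, ∑ i, (inner ℝ x (a i)) ^ 2 ≤ M * ‖x‖ ^ 2) (c : Fin m → ℝ) :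
    ‖∑ i, c i • a i‖ ^ 2 ≤ (∑ i, c i ^ 2) * M := by
  set D := ∑ i, c i • a i with hD
  have hc : 0 ≤ ∑ i, c i ^ 2 := Finset.sum_nonneg fun i _ => sq_nonneg _
  have h1 : ‖D‖ ^ 2 = ∑ i, c i * inner ℝ D (a i) := by
    rw [← real_inner_self_eq_norm_sq]
    conv_lhs => rw [hD, ← hD, inner_sum]
    simp only [real_inner_smul_right]
  have h2 : (‖D‖ ^ 2) ^ 2 ≤ (∑ i, c i ^ 2) * (M * ‖D‖ ^ 2) := by
    rw [h1]
    refine (Finset.sum_mul_sq_le_sq_mul_sq _ _ _).trans ?_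
    rw [← h1]
    exact mul_le_mul_of_nonneg_left (hM D) hc
  rcases (sq_nonneg ‖D‖).eq_or_lt with h0 | h0
  · rw [← h0]; positivity
  · refine le_of_mul_le_mul_right ?_ h0
    nlinarith

lemma seven_tenths_le_sqrt_two_div_pi : 7 / 10 ≤ √(2 / π) := by
  refine le_sqrt_of_sq_le ?_
  rw [le_div_iff₀ pi_pos]
  nlinarith [pi_lt_d2]

lemma sqrt_two_div_pi_le_one : √(2 / π) ≤ 1 := by
  rw [sqrt_le_one, div_le_one pi_pos]
  linarith [pi_gt_three]

/-- If the three statistics are controlled on an `ε`-net with `ε = δ³ / 2¹⁹`, then the weighted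
average of the `a i` is close to `√(2 / π) x` for every unit vector `x` at once. With threshold
`τ = δ² / 4096` the two kinds of indices whose sign may change, `|⟨y, a i⟩| ≤ τ` and
`|⟨x - y, a i⟩| ≥ τ`, each contribute at most `m δ² / 1024`; the second bound is
`16 m (ε / τ)²`. -/
lemma norm_sign_average_sub_le {m : ℕ} (hm : 0 < m) {a : Fin m → E} {N : Finset E} {δ : ℝ}
    (hδ : 0 < δ) (hδ1 : δ ≤ 1)
    (hcov : ∀ x : E, ‖x‖ = 1 → ∃ y ∈ N, dist x y ≤ δ ^ 3 / 2 ^ 19)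
    (h1 : ∀ x ∈ N, ∑ i, (if |inner ℝ x (a i)| ≤ δ ^ 2 / 4096 then (1 : ℝ) else 0) ≤
      m * (δ ^ 2 / 1024))
    (h2 : ∀ y ∈ N, ∑ i, (inner ℝ y (a i)) ^ 2 ≤ 4 * (m : ℝ))
    (h3 : ∀ x ∈ N, ∀ y ∈ N, ∑ i, (Real.sign (inner ℝ x (a i)) * inner ℝ y (a i) -
      √(2 / π) * inner ℝ x y) ≤ m * (δ / 16))
    {x : E} (hx : ‖x‖ = 1) {t : Fin m → ℝ} (ht : ∀ i, |t i| ≤ 1)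
    (hts : ∀ i, inner ℝ x (a i) ≠ 0 → t i = Real.sign (inner ℝ x (a i))) :
    ‖(1 / (m : ℝ)) • ∑ i, t i • a i - √(2 / π) • x‖ ≤ √(2 / π) * δ := by
  have hm' : (0 : ℝ) < m := by exact_mod_cast hm
  have hδ3 : δ ^ 3 ≤ δ := by
    have : δ ^ 2 ≤ 1 := pow_le_one₀ hδ.le hδ1
    nlinarith
  have hε : δ ^ 3 / 2 ^ 19 ≤ 1 / 2 := by linarith
  obtain ⟨y, hy, hd⟩ := hcov x hx
  rw [dist_eq_norm] at hd
  set κ := √(2 / π) with hκ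
  have hκ1 : 7 / 10 ≤ κ := seven_tenths_le_sqrt_two_div_pi
  have hκ2 : κ ≤ 1 := sqrt_two_div_pi_le_one
  have hquad : ∀ z : E, ∑ i, (inner ℝ z (a i)) ^ 2 ≤ 16 * m * ‖z‖ ^ 2 := by
    intro z
    have := sum_inner_sq_le_of_net hε hcov (a := a) (B := 2 * √(m : ℝ)) (by positivity)
      (fun y hy => (h2 y hy).trans_eq (by rw [mul_pow, sq_sqrt hm'.le]; norm_num)) z
    refine this.trans_eq ?_
    rw [mul_pow, mul_pow, mul_pow, sq_sqrt hm'.le]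
    ring
  -- The value at the net point.
  have hV : ‖(1 / (m : ℝ)) • ∑ i, Real.sign (inner ℝ y (a i)) • a i - κ • y‖ ≤ 2 * (δ / 16) := by
    refine norm_le_two_mul_of_net hε hcov (by positivity) fun z hz => ?_
    have h := h3 y hy z hz
    rw [Finset.sum_sub_distrib, Finset.sum_const, Finset.card_univ, Fintype.card_fin,
      nsmul_eq_mul] at h
    rw [inner_sub_right, real_inner_smul_right, real_inner_smul_right, inner_sum,
      real_inner_comm y z]
    simp only [real_inner_smul_right]
    rw [one_div, inv_mul_eq_div, sub_le_iff_le_add, div_le_iff₀ hm']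
    linarith
  -- The cost of moving from `x` to the net point inside the signs.
  have hsq : ∑ i, (t i - Real.sign (inner ℝ y (a i))) ^ 2 ≤ m * (δ ^ 2 / 128) := by
    have hτ : 0 < δ ^ 2 / 4096 := by positivity
    have hxy : ∑ i, (inner ℝ x (a i) - inner ℝ y (a i)) ^ 2 ≤ 16 * m * (δ ^ 3 / 2 ^ 19) ^ 2 := by
      simp only [← inner_sub_left]
      refine (hquad _).trans ?_
      gcongr
    calc _ ≤ ∑ i, 4 * ((if |inner ℝ y (a i)| ≤ δ ^ 2 / 4096 then (1 : ℝ) else 0) +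
          (inner ℝ x (a i) - inner ℝ y (a i)) ^ 2 / (δ ^ 2 / 4096) ^ 2) :=
          Finset.sum_le_sum fun i _ => sq_sub_sign_le hτ (ht i) (hts i)
      _ ≤ 4 * (m * (δ ^ 2 / 1024) +
          16 * m * (δ ^ 3 / 2 ^ 19) ^ 2 / (δ ^ 2 / 4096) ^ 2) := by
        rw [← Finset.mul_sum, Finset.sum_add_distrib, ← Finset.sum_div]
        gcongr
        exact h1 y hy
      _ = _ := by field_simp; norm_num
  have hD : ‖(1 / (m : ℝ)) • ∑ i, (t i - Real.sign (inner ℝ y (a i))) • a i‖ ≤ 3 / 8 * δ := by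
    have h := norm_sum_smul_sq_le (by positivity) hquad
      (fun i => t i - Real.sign (inner ℝ y (a i)))
    have h' : ‖∑ i, (t i - Real.sign (inner ℝ y (a i))) • a i‖ ^ 2 ≤ (m * (3 / 8 * δ)) ^ 2 := by
      refine h.trans ((mul_le_mul_of_nonneg_right hsq (by positivity)).trans ?_)
      nlinarith [mul_pos hm' hδ, sq_nonneg ((m : ℝ) * δ)]
    have h'' := abs_le_of_sq_le_sq' h' (by positivity) |>.2
    rw [norm_smul, norm_of_nonneg (by positivity), one_div, inv_mul_le_iff₀ hm']
    exact h''
  have hκx : ‖κ • (y - x)‖ ≤ δ / 16 := by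
    rw [norm_smul, norm_of_nonneg (by linarith), norm_sub_rev]
    have : κ * ‖x - y‖ ≤ 1 * (δ ^ 3 / 2 ^ 19) := by gcongr
    linarith
  have hsplit : (1 / (m : ℝ)) • ∑ i, t i • a i - κ • x =
      ((1 / (m : ℝ)) • ∑ i, Real.sign (inner ℝ y (a i)) • a i - κ • y) +
      (1 / (m : ℝ)) • ∑ i, (t i - Real.sign (inner ℝ y (a i))) • a i + κ • (y - x) := by
    simp only [sub_smul, Finset.sum_sub_distrib, smul_sub]
    abel
  rw [hsplit]
  refine (norm_add₃_le).trans ?_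
  have : 7 / 10 * δ ≤ κ * δ := by gcongr
  linarith

end Deterministic

/-! ### The union bound -/

section UnionBound

/-- With `ε = δ³ / 2¹⁹` this bounds the base of the net size `(3 / ε) ^ n`, so that a union bound
over the net costs only a factor `δ⁻²` in the number of samples. -/
lemma three_div_le_exp {δ : ℝ} (hδ : 0 < δ) (hδ1 : δ ≤ 1) :
    3 / (δ ^ 3 / 2 ^ 19) ≤ exp (20 / δ ^ 2) := by
  have h1 : 1 ≤ 1 / δ ^ 2 := by
    rw [one_le_div (by positivity)]
    exact pow_le_one₀ hδ.le hδ1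
  have h2 : 1 / δ ≤ exp (1 / δ ^ 2) := by
    have : 1 / δ ≤ 1 / δ ^ 2 := one_div_le_one_div_of_le (by positivity) (by nlinarith)
    linarith [add_one_le_exp (1 / δ ^ 2)]
  have h3 : (3 * 2 ^ 19 : ℝ) ≤ exp (17 * (1 / δ ^ 2)) := by
    have he : (2.7 : ℝ) ^ 17 ≤ exp 1 ^ 17 :=
      pow_le_pow_left₀ (by norm_num) (by linarith [exp_one_gt_d9]) 17
    rw [← exp_nat_mul] at he
    have : exp ((17 : ℕ) * 1) ≤ exp (17 * (1 / δ ^ 2)) := exp_le_exp.2 (by push_cast; linarith)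
    refine le_trans ?_ (he.trans this)
    norm_num
  calc 3 / (δ ^ 3 / 2 ^ 19) = 3 * 2 ^ 19 * (1 / δ) ^ 3 := by field_simp
    _ ≤ exp (17 * (1 / δ ^ 2)) * exp (1 / δ ^ 2) ^ 3 := by gcongr
    _ = _ := by
      rw [← exp_nat_mul, ← exp_add]
      congr 1
      push_cast
      ring

variable (E : Type*) [NormedAddCommGroup E] [InnerProductSpace ℝ E] [FiniteDimensional ℝ E]
  [MeasurableSpace E] [BorelSpace E]

/-- Uniform concentration of the sign-weighted average of `m` standard Gaussian vectors. -/
lemma measure_pi_stdGaussian_sign_average_le {m : ℕ} {δ : ℝ} (hδ : 0 < δ) (hδ1 : δ ≤ 1)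
    (hmn : 491520 / δ ^ 4 * (Module.finrank ℝ E : ℝ) ≤ m) :
    Measure.pi (fun _ : Fin m => stdGaussian E) {a | ¬ ∀ x : E, ‖x‖ = 1 → ∀ t : Fin m → ℝ,
      (∀ i, |t i| ≤ 1) →
      (∀ i, inner ℝ x (a i) ≠ 0 → t i = Real.sign (inner ℝ x (a i))) →
      ‖(1 / (m : ℝ)) • ∑ i, t i • a i - √(2 / π) • x‖ ≤ √(2 / π) * δ} ≤
    ENNReal.ofReal (3 * exp (-(1 / 12288 * m * δ ^ 4))) := by
  have hmn' : 491520 * (Module.finrank ℝ E : ℝ) ≤ m * δ ^ 4 := by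
    rwa [div_mul_eq_mul_div, div_le_iff₀ (by positivity)] at hmn
  rcases Nat.eq_zero_or_pos m with rfl | hm
  · have hn : Module.finrank ℝ E = 0 := by
      have h0 : (Module.finrank ℝ E : ℝ) ≤ 0 := by
        rw [Nat.cast_zero, zero_mul] at hmn'
        linarith
      exact_mod_cast le_antisymm h0 (Nat.cast_nonneg _)
    have hE : Subsingleton E := Module.finrank_zero_iff.1 hn
    refine (measure_mono_null ?_ measure_empty).trans_le zero_le
    intro a ha
    refine ha fun x hx => ?_
    rw [Subsingleton.elim x 0, norm_zero] at hx
    exact absurd hx zero_ne_one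
  have hm' : (0 : ℝ) < m := by exact_mod_cast hm
  have hε : 0 < δ ^ 3 / 2 ^ 19 := by positivity
  have hε1 : δ ^ 3 / 2 ^ 19 ≤ 1 := by
    have : δ ^ 3 ≤ 1 := pow_le_one₀ hδ.le hδ1
    linarith
  have hδ2 : δ ^ 2 ≤ 1 := pow_le_one₀ hδ.le hδ1
  obtain ⟨N, hN, hcov, hcard⟩ := exists_finset_sphere_net E hε hε1
  -- The bad event at a pair of net points: one of the three statistics is too large.
  let B : E × E → Set (Fin m → E) := fun p =>
    {a | m * (δ ^ 2 / 1024) ≤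
      ∑ i, (if |inner ℝ p.1 (a i)| ≤ δ ^ 2 / 4096 then (1 : ℝ) else 0)} ∪
    {a | (m : ℝ) ≤ ∑ i, 1 / 4 * (inner ℝ p.1 (a i)) ^ 2} ∪
    {a | δ / 192 * (m * (δ / 16)) ≤ ∑ i, δ / 192 * (Real.sign (inner ℝ p.1 (a i)) *
      inner ℝ p.2 (a i) - √(2 / π) * inner ℝ p.1 p.2)}
  set β := ENNReal.ofReal (exp (-(m * δ ^ 2 / 6144))) with hβ
  have hB : ∀ p ∈ N ×ˢ N, Measure.pi (fun _ : Fin m => stdGaussian E) (B p) ≤ 3 * β := by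
    intro p hp
    obtain ⟨hp1, hp2⟩ := Finset.mem_product.1 hp
    have e1 := measure_pi_le_sum_le_exp (stdGaussian E)
      (f := fun a => if |inner ℝ p.1 a| ≤ δ ^ 2 / 4096 then (1 : ℝ) else 0)
      (Measurable.ite (measurableSet_le (by fun_prop) (by fun_prop)) (by fun_prop) (by fun_prop))
      (lintegral_exp_indicator_abs_inner_le (hN _ hp1) (by positivity)) m (m * (δ ^ 2 / 1024))
    have e2 := measure_pi_le_sum_le_exp (stdGaussian E) (by fun_prop)
      (lintegral_exp_inner_sq_le (hN _ hp1)) m m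
    have hsm : Measurable fun a : E => Real.sign (inner ℝ p.1 a) :=
      Real.measurable_sign.comp (by fun_prop)
    -- The choice `δ / 192` optimizes the exponent `6 t² - t δ / 16`.
    have e3 := measure_pi_le_sum_le_exp (stdGaussian E) (by fun_prop)
      (lintegral_exp_sign_inner_mul_inner_le (hN _ hp1) (hN _ hp2) (t := δ / 192)
        (by nlinarith)) m (δ / 192 * (m * (δ / 16)))
    have hmδ : (m : ℝ) * δ ^ 2 ≤ m := mul_le_of_le_one_right hm'.le hδ2
    have hmδ0 : 0 ≤ (m : ℝ) * δ ^ 2 := by positivity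
    calc _ ≤ β + β + β := by
          refine (measure_union_le _ _).trans (add_le_add ((measure_union_le _ _).trans
            (add_le_add (e1.trans ?_) (e2.trans ?_))) (e3.trans ?_)) <;>
          refine ENNReal.ofReal_le_ofReal (exp_le_exp.2 ?_) <;> linarith
      _ = 3 * β := by ring
  have hsub : {a : Fin m → E | ¬ ∀ x : E, ‖x‖ = 1 → ∀ t : Fin m → ℝ, (∀ i, |t i| ≤ 1) →
      (∀ i, inner ℝ x (a i) ≠ 0 → t i = Real.sign (inner ℝ x (a i))) →
      ‖(1 / (m : ℝ)) • ∑ i, t i • a i - √(2 / π) • x‖ ≤ √(2 / π) * δ} ⊆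
      ⋃ p ∈ N ×ˢ N, B p := by
    intro a ha
    by_contra hcon
    have hnot : ∀ x ∈ N, ∀ y ∈ N, a ∉ B (x, y) := fun x hx y hy hmem =>
      hcon (Set.mem_biUnion (Finset.mem_coe.2 (Finset.mk_mem_product hx hy)) hmem)
    simp only [B, Set.mem_union, Set.mem_ofPred_eq, not_or, not_le] at hnot
    refine ha fun x hx t ht hts => norm_sign_average_sub_le hm hδ hδ1 hcov
      (fun x hx => (hnot x hx x hx).1.1.le) (fun y hy => ?_) (fun x hx y hy => ?_) hx ht hts
    · have := (hnot y hy y hy).1.2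
      rw [← Finset.mul_sum] at this
      linarith
    · have := (hnot x hx y hy).2
      rw [← Finset.mul_sum] at this
      exact (lt_of_mul_lt_mul_left this (by positivity)).le
  have hcard2 : ((N ×ˢ N).card : ℝ) ≤ exp (40 * Module.finrank ℝ E / δ ^ 2) := by
    have : (N.card : ℝ) ≤ exp (20 / δ ^ 2) ^ Module.finrank ℝ E :=
      hcard.trans (pow_le_pow_left₀ (by positivity) (three_div_le_exp hδ hδ1) _)
    rw [Finset.card_product, Nat.cast_mul]
    refine (mul_le_mul this this (by positivity) (by positivity)).trans_eq ?_
    rw [← exp_nat_mul, ← exp_add]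
    congr 1
    ring
  calc _ ≤ Measure.pi (fun _ : Fin m => stdGaussian E) (⋃ p ∈ N ×ˢ N, B p) := measure_mono hsub
    _ ≤ ∑ p ∈ N ×ˢ N, Measure.pi (fun _ : Fin m => stdGaussian E) (B p) :=
      measure_biUnion_finset_le _ _
    _ ≤ ∑ p ∈ N ×ˢ N, 3 * β := Finset.sum_le_sum hB
    _ = ENNReal.ofReal ((N ×ˢ N).card * (3 * exp (-(m * δ ^ 2 / 6144)))) := by
      rw [Finset.sum_const, nsmul_eq_mul, ENNReal.ofReal_mul (by positivity),
        ENNReal.ofReal_natCast, ENNReal.ofReal_mul (by positivity), hβ]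
      simp
    _ ≤ _ := by
      refine ENNReal.ofReal_le_ofReal ?_
      have hexp : 40 * (Module.finrank ℝ E : ℝ) / δ ^ 2 - m * δ ^ 2 / 6144 ≤
          -(1 / 12288 * m * δ ^ 4) := by
        have h1 : 40 * (Module.finrank ℝ E : ℝ) / δ ^ 2 ≤ m * δ ^ 2 / 12288 := by
          rw [div_le_iff₀ (by positivity)]
          nlinarith
        have h2 : (m : ℝ) * δ ^ 4 ≤ m * δ ^ 2 := by
          have : δ ^ 4 ≤ δ ^ 2 := pow_le_pow_of_le_one hδ.le hδ1 (by norm_num)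
          gcongr
        linarith
      calc _ ≤ exp (40 * Module.finrank ℝ E / δ ^ 2) * (3 * exp (-(m * δ ^ 2 / 6144))) := by
            gcongr
        _ = 3 * exp (40 * Module.finrank ℝ E / δ ^ 2 - m * δ ^ 2 / 6144) := by
            rw [mul_left_comm, ← exp_add]; ring_nf
        _ ≤ _ := by gcongr

end UnionBound

/-! ### Matrices as Euclidean vectors -/

/-- The entries of a square matrix as a vector of the Euclidean space indexed by pairs. -/
def matrixVec (d : ℕ) : Matrix (Fin d) (Fin d) ℝ →ₗ[ℝ] EuclideanSpace ℝ (Fin d × Fin d) where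
  toFun X := WithLp.toLp 2 fun p => X p.1 p.2
  map_add' _ _ := rfl
  map_smul' _ _ := rfl

lemma matrixVec_apply {d : ℕ} (X : Matrix (Fin d) (Fin d) ℝ) (p : Fin d × Fin d) :
    matrixVec d X p = X p.1 p.2 := rfl

lemma frobInner_eq_inner_matrixVec {d : ℕ} (X Y : Matrix (Fin d) (Fin d) ℝ) :
    frobInner X Y = inner ℝ (matrixVec d X) (matrixVec d Y) := by
  simp only [frobInner, Matrix.trace, Matrix.diag, Matrix.mul_apply, Matrix.transpose_apply,
    matrixVec_apply, PiLp.inner_apply, RCLike.inner_apply,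
    conj_trivial, Fintype.sum_prod_type]
  rw [Finset.sum_comm]
  simp only [mul_comm]

lemma norm_matrixVec {d : ℕ} (X : Matrix (Fin d) (Fin d) ℝ) : ‖matrixVec d X‖ = ‖X‖ := by
  rw [Matrix.frobenius_norm_def, EuclideanSpace.norm_eq, Real.sqrt_eq_rpow]
  simp [matrixVec_apply, Fintype.sum_prod_type]

lemma IsStdGaussianEnsemble.aemeasurable {Ω : Type*} [MeasurableSpace Ω] {μ : Measure Ω}
    {d m : ℕ} {A : Fin m → Ω → Matrix (Fin d) (Fin d) ℝ} (hA : IsStdGaussianEnsemble μ A) :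
    AEMeasurable (fun ω i => matrixVec d (A i ω)) μ := by
  refine aemeasurable_pi_lambda _ fun i => ?_
  have h : AEMeasurable (fun ω (p : Fin d × Fin d) => A i ω p.1 p.2) μ :=
    aemeasurable_pi_lambda _ fun p => (hA.law i p.1 p.2).aemeasurable
  exact (by fun_prop : Measurable (WithLp.toLp 2 : (Fin d × Fin d → ℝ) → _)).comp_aemeasurable h

lemma IsStdGaussianEnsemble.map_eq {Ω : Type*} [MeasurableSpace Ω] {μ : Measure Ω}
    [IsProbabilityMeasure μ]
    {d m : ℕ} {A : Fin m → Ω → Matrix (Fin d) (Fin d) ℝ} (hA : IsStdGaussianEnsemble μ A) :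
    μ.map (fun ω i => matrixVec d (A i ω)) =
      Measure.pi (fun _ : Fin m => stdGaussian (EuclideanSpace ℝ (Fin d × Fin d))) := by
  have hm : ∀ p : Fin m × Fin d × Fin d, AEMeasurable (fun ω => A p.1 ω p.2.1 p.2.2) μ :=
    fun p => (hA.law p.1 p.2.1 p.2.2).aemeasurable
  have h := (iIndepFun_iff_map_fun_eq_pi_map hm).1 hA.indep
  simp only [(hA.law _ _ _).map_eq] at h
  have hcurry : (Measure.pi fun _ : Fin m × Fin d × Fin d => gaussianReal 0 1).map
      (MeasurableEquiv.curry (Fin m) (Fin d × Fin d) ℝ) =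
      Measure.pi fun _ : Fin m => Measure.pi fun _ : Fin d × Fin d => gaussianReal 0 1 := by
    have := Measure.infinitePi_map_curry (fun (_ : Fin m) (_ : Fin d × Fin d) => gaussianReal 0 1)
    simpa only [Measure.infinitePi_eq_pi] using this
  have hlp : (Measure.pi fun _ : Fin m => Measure.pi fun _ : Fin d × Fin d =>
      gaussianReal 0 1).map (fun a i => WithLp.toLp 2 (a i)) =
      Measure.pi (fun _ : Fin m => stdGaussian (EuclideanSpace ℝ (Fin d × Fin d))) := by
    rw [Measure.pi_map_pi (fun _ => by fun_prop)]
    simp only [map_pi_eq_stdGaussian]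
  rw [← hlp, ← hcurry, ← h, Measure.map_map (by fun_prop) (by fun_prop),
    AEMeasurable.map_map_of_aemeasurable (by fun_prop) (aemeasurable_pi_lambda _ hm)]
  rfl

lemma signSet_spec {x t : ℝ} (h : t ∈ signSet x) : |t| ≤ 1 ∧ (x ≠ 0 → t = Real.sign x) := by
  have hs : x ≠ 0 → t = Real.sign x := by
    intro hx
    rw [h.1 hx]
    rcases lt_or_gt_of_ne hx with hx' | hx'
    · rw [Real.sign_of_neg hx', abs_of_neg hx', div_neg, div_self hx]
    · rw [Real.sign_of_pos hx', abs_of_pos hx', div_self hx]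
  refine ⟨?_, hs⟩
  by_cases hx : x = 0
  · exact abs_le.2 (h.2 hx)
  · rw [hs hx]
    exact Real.abs_sign_le_one x

/-- Only the directions of unit norm matter: the sign weights do not change when `X` is rescaled,
and `‖·‖_{F,r}` is at most the Frobenius norm. -/
lemma signRIP_of_forall_norm_sub_le {d m r : ℕ} {A : Fin m → Matrix (Fin d) (Fin d) ℝ} {δ κ : ℝ}
    (h0 : 0 ≤ κ * δ)
    (h : ∀ x : EuclideanSpace ℝ (Fin d × Fin d), ‖x‖ = 1 → ∀ t : Fin m → ℝ, (∀ i, |t i| ≤ 1) →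
      (∀ i, inner ℝ x (matrixVec d (A i)) ≠ 0 →
        t i = Real.sign (inner ℝ x (matrixVec d (A i)))) →
      ‖(1 / (m : ℝ)) • ∑ i, t i • matrixVec d (A i) - κ • x‖ ≤ κ * δ) :
    SignRIP A (0 : Fin m → ℝ) r δ (fun _ => κ) := by
  rintro X hX - Q ⟨t, ht, rfl⟩
  have hX0 : 0 < ‖X‖ := norm_pos_iff.2 hX
  have hinner : ∀ i, inner ℝ ((‖X‖⁻¹ : ℝ) • matrixVec d X) (matrixVec d (A i)) =
      ‖X‖⁻¹ * frobInner (A i) X := by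
    intro i
    rw [real_inner_smul_left, real_inner_comm, frobInner_eq_inner_matrixVec]
  have hx := h ((‖X‖⁻¹ : ℝ) • matrixVec d X)
    (by rw [norm_smul, norm_inv, norm_norm, norm_matrixVec, inv_mul_cancel₀ hX0.ne']) t
    (fun i => (signSet_spec (ht i)).1) (fun i hi => by
      rw [hinner] at hi ⊢
      have hne : frobInner (A i) X ≠ 0 := right_ne_zero_of_mul hi
      have hs := (signSet_spec (ht i)).2
      simp only [Pi.zero_apply, sub_zero] at hs
      rw [hs hne]
      rcases lt_or_gt_of_ne hne with h' | h'
      · rw [Real.sign_of_neg h', Real.sign_of_neg (mul_neg_of_pos_of_neg (inv_pos.2 hX0) h')]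
      · rw [Real.sign_of_pos h', Real.sign_of_pos (mul_pos (inv_pos.2 hX0) h')])
  refine Real.sSup_le ?_ h0
  rintro _ ⟨Y, ⟨hY, -⟩, rfl⟩
  rw [frobInner_eq_inner_matrixVec]
  refine (real_inner_le_norm _ _).trans ?_
  rw [norm_matrixVec Y, hY, mul_one]
  refine le_of_eq_of_le (congrArg norm ?_) hx
  rw [map_sub, map_smul, map_smul, map_sum, smul_smul, div_eq_mul_inv κ]
  simp only [map_smul]

end

theorem mainTheorem8 :
    ∃ C c K : ℝ, 0 < C ∧ 0 < c ∧ 0 < K ∧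
      ∀ (d r m : ℕ) (δ : ℝ), 0 < δ → δ ≤ Real.sqrt (2 / Real.pi) →
        (K / δ ^ 4) * (d : ℝ) ^ 2 ≤ (m : ℝ) →
        ∀ (Ω : Type*) [MeasurableSpace Ω] (μ : MeasureTheory.Measure Ω)
          [MeasureTheory.IsProbabilityMeasure μ] (A : Fin m → Ω → Matrix (Fin d) (Fin d) ℝ),
          IsStdGaussianEnsemble μ A →
          μ {ω | ¬ SignRIP (fun i => A i ω) (0 : Fin m → ℝ) r δ
              (fun _ => Real.sqrt (2 / Real.pi))} ≤
            ENNReal.ofReal (C * Real.exp (-(c * (m : ℝ) * δ ^ 4))) := by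
  refine ⟨3, 1 / 12288, 491520, by norm_num, by norm_num, by norm_num, ?_⟩
  intro d r m δ hδ hδκ hm Ω _ μ _ A hA
  have hfin : (Module.finrank ℝ (EuclideanSpace ℝ (Fin d × Fin d)) : ℝ) = (d : ℝ) ^ 2 := by
    rw [finrank_euclideanSpace, Fintype.card_prod, Fintype.card_fin]
    push_cast
    ring
  rw [← hfin] at hm
  refine le_trans ?_ (measure_pi_stdGaussian_sign_average_le
    (EuclideanSpace ℝ (Fin d × Fin d)) hδ (hδκ.trans sqrt_two_div_pi_le_one) hm)
  rw [← hA.map_eq]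
  refine (MeasureTheory.measure_mono ?_).trans
    (MeasureTheory.Measure.le_map_apply hA.aemeasurable _)
  exact fun ω hω hgood => hω (signRIP_of_forall_norm_sub_le (by positivity) hgood)
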